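/- Let $\mathcal H\neq\{0\}$ be a complex Hilbert space, $\mathbb K(\mathcal H)$ the $C^*$-algebra of compact operators on $\mathcal H$, and let $\mathscr X$ be a Hilbert $\mathbb K(\mathcal H)$-module: a complex vector space and left $\mathbb K(\mathcal H)$-module with a $\mathbb K(\mathcal H)$-valued inner product $\langle\cdot,\cdot\rangle$ that is $\mathbb C$-linear and $\mathbb K(\mathcal H)$-linear in the first variable, satisfies $\langle x,y\rangle^*=\langle y,x\rangle$ and $\langle x,x\rangle\ge 0$ with equality only for $x=0$, and such that $\mathscr X$ is complete in the norm $\|x\|=\|\langle x,x\rangle\|^{1/2}$. Let $\mathbb P(\mathcal H)$ be the set of positive trace-class operators $p$ on $\mathcal H$ with $\operatorname{tr}(p)=1$. For $x,y\in\mathscr X$ the limits $$\rho_{\pm}(x,y)=\lim_{t\to0^{\pm}}\frac{\|x+ty\|^2-\|x\|^2}{2t}$$ exist, and $$\rho_{+}(x,y)=\max\bigl\{\operatorname{Re}\operatorname{tr}(p\langle x,y\rangle):\ p\in\mathbb P(\mathcal H),\ \operatorname{tr}(p\langle x,x\rangle)=\|x\|^2\bigr\},$$ $$\rho_{-}(x,y)=\min\bigl\{\operatorname{Re}\operatorname{tr}(p\langle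 x,y\rangle):\ p\in\mathbb P(\mathcal H),\ \operatorname{tr}(p\langle x,x\rangle)=\|x\|^2\bigr\};$$ in particular the maximum and the minimum are attained. -/

import Mathlib

open Filter Topology
open scoped InnerProductSpace

noncomputable section

section CompactOperators

variable (H : Type*) [NormedAddCommGroup H] [InnerProductSpace ℂ H] [CompleteSpace H]

variable {H} in
/-- The adjoint of a compact operator on a Hilbert space is compact. -/
theorem isCompactOperator_star {T : H →L[ℂ] H} (hT : IsCompactOperator T) :
    IsCompactOperator (star T : H →L[ℂ] H) := by
  have hTT : IsCompactOperator (T * star T : H →L[ℂ] H) := hT.comp_clm (star T)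
  have h1 := hTT.isCompact_closure_image_ball (f := ((T * star T : H →L[ℂ] H) : H →ₗ[ℂ] H)) 1
  have h2 : TotallyBounded ((T * star T : H →L[ℂ] H) '' Metric.ball (0 : H) 1) :=
    h1.totallyBounded.subset subset_closure
  refine (isCompactOperator_iff_isCompact_closure_image_ball
    (f := ((star T : H →L[ℂ] H) : H →ₗ[ℂ] H)) one_pos).2 ?_
  refine TotallyBounded.isCompact_of_isClosed (TotallyBounded.closure ?_) isClosed_closure
  rw [Metric.totallyBounded_iff]
  intro ε hε
  obtain ⟨t, ht, htf, hcov⟩ := Metric.finite_approx_of_totallyBounded h2 (ε ^ 2 / 2) (by positivity)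
  obtain ⟨s, hs, rfl⟩ : ∃ s ⊆ Metric.ball (0 : H) 1, (T * star T : H →L[ℂ] H) '' s = t :=
    Set.subset_image_iff.1 ht
  obtain ⟨s', hs', hs'f, hs'e⟩ := Set.exists_subset_image_finite_and.1
    ⟨_, subset_rfl, htf, (rfl : (T * star T : H →L[ℂ] H) '' s = _)⟩
  refine ⟨(star T : H →L[ℂ] H) '' s', hs'f.image _, ?_⟩
  rintro _ ⟨x, hx, rfl⟩
  have hx' := hcov (Set.mem_image_of_mem _ hx)
  rw [hs'e] at hx'
  simp only [Set.mem_iUnion, exists_prop, Set.exists_mem_image] at hx' ⊢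
  obtain ⟨y, hy, hxy⟩ := hx'
  refine ⟨y, hy, ?_⟩
  have hy1 := hs (hs' hy)
  rw [mem_ball_zero_iff] at hx hy1
  rw [Metric.mem_ball, dist_eq_norm] at hxy ⊢
  have e1 : ((star T : H →L[ℂ] H) : H →ₗ[ℂ] H) x - (star T : H →L[ℂ] H) y
      = (star T : H →L[ℂ] H) (x - y) := by simp
  rw [← map_sub] at hxy
  rw [e1]
  have key : ‖(star T : H →L[ℂ] H) (x - y)‖ ^ 2
      ≤ ‖(T * star T : H →L[ℂ] H) (x - y)‖ * ‖x - y‖ := by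
    have : ‖(star T : H →L[ℂ] H) (x - y)‖ ^ 2
        = RCLike.re ⟪(T * star T : H →L[ℂ] H) (x - y), x - y⟫_ℂ := by
      rw [← inner_self_eq_norm_sq (𝕜 := ℂ)]
      conv_lhs => rw [ContinuousLinearMap.star_eq_adjoint, ContinuousLinearMap.adjoint_inner_right]
      rfl
    rw [this]
    exact (RCLike.re_le_norm _).trans (norm_inner_le_norm _ _)
  have h2 : ‖x - y‖ < 2 := (norm_sub_le x y).trans_lt (by linarith)
  refine lt_of_pow_lt_pow_left₀ 2 hε.le (key.trans_lt ?_)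
  nlinarith [norm_nonneg (x - y), norm_nonneg ((T * star T : H →L[ℂ] H) (x - y))]

/-- The C⋆-algebra `𝕂(H)` of compact operators on the Hilbert space `H`, as a star subalgebra of the
bounded operators (with the operator norm, the adjoint, and the order of bounded operators). -/
def compactOperators : NonUnitalStarSubalgebra ℂ (H →L[ℂ] H) where
  carrier := {T | IsCompactOperator T}
  add_mem' hS hT := hS.add hT
  zero_mem' := isCompactOperator_zero
  smul_mem' c _ hT := hT.smul c
  mul_mem' {_ T} hS _ := hS.comp_clm T
  star_mem' hT := isCompactOperator_star hT

instance : IsClosed (compactOperators H : Set (H →L[ℂ] H)) :=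
  isClosed_setOfPred_isCompactOperator

/-- A self-adjoint element of a C⋆-algebra is a difference `b⋆b - m` with `m = c⋆c` and
`m a m = -(cm)⋆(cm)`. -/
theorem exists_star_mul_self_sub {A : Type*} [NonUnitalCStarAlgebra A] (a : A)
    (hsa : IsSelfAdjoint a) : ∃ b c m : A, star m = m ∧ m = star c * c ∧
      a = star b * b - m ∧ m * a * m = -(star (c * m) * (c * m)) := by
  have hq : ∀ f : ℝ → ℝ, IsSelfAdjoint (cfcₙ f a) := fun f => cfcₙ_predicate f a
  have hm : star a⁻ = a⁻ := (hq _).star_eq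
  have hcs : star (cfcₙ (fun x : ℝ => √(x⁻)) a) = cfcₙ (fun x : ℝ => √(x⁻)) a := (hq _).star_eq
  have hbs : star (cfcₙ (fun x : ℝ => √(x⁺)) a) = cfcₙ (fun x : ℝ => √(x⁺)) a := (hq _).star_eq
  have hcc : a⁻ = cfcₙ (fun x : ℝ => √(x⁻)) a * cfcₙ (fun x : ℝ => √(x⁻)) a := by
    rw [← cfcₙ_mul (fun x : ℝ => √(x⁻)) (fun x : ℝ => √(x⁻)) a, CFC.negPart_def]
    congr 1
    ext x
    exact (Real.mul_self_sqrt (negPart_nonneg x)).symm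
  have hbb : a⁺ = cfcₙ (fun x : ℝ => √(x⁺)) a * cfcₙ (fun x : ℝ => √(x⁺)) a := by
    rw [← cfcₙ_mul (fun x : ℝ => √(x⁺)) (fun x : ℝ => √(x⁺)) a, CFC.posPart_def]
    congr 1
    ext x
    exact (Real.mul_self_sqrt (posPart_nonneg x)).symm
  generalize cfcₙ (fun x : ℝ => √(x⁻)) a = c at *
  generalize cfcₙ (fun x : ℝ => √(x⁺)) a = b at *
  refine ⟨b, c, a⁻, hm, by rw [hcs, hcc], by rw [hbs, ← hbb, CFC.posPart_sub_negPart a hsa], ?_⟩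
  have h1 : a⁻ * a = -(a⁻ * a⁻) := by
    have := congrArg (fun z => a⁻ * z) (CFC.posPart_sub_negPart a hsa)
    simpa [mul_sub] using this.symm
  rw [h1, star_mul, hm, hcs, neg_mul, mul_assoc a⁻ c, ← mul_assoc c c, ← hcc, mul_assoc]

/-- An element of `𝕂(H)` is positive iff it is of the form `b⋆b` with `b` in `𝕂(H)`. -/
theorem compactOperators_nonneg_iff (a : compactOperators H) :
    0 ≤ a ↔ ∃ b : compactOperators H, a = star b * b := by
  constructor
  · intro ha
    have ha' : (0 : H →L[ℂ] H) ≤ a := ha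
    have hsa : IsSelfAdjoint a := Subtype.ext (IsSelfAdjoint.of_nonneg ha').star_eq
    obtain ⟨b, c, m, hm, hmc, hab, hmam⟩ := exists_star_mul_self_sub a hsa
    have h2 : (0 : H →L[ℂ] H) ≤ star (m : H →L[ℂ] H) * a * m :=
      star_left_conjugate_nonneg ha' (m : H →L[ℂ] H)
    have h3 : (0 : H →L[ℂ] H) ≤ star ((c * m : compactOperators H) : H →L[ℂ] H) *
        (c * m : compactOperators H) := star_mul_self_nonneg _
    have e1 : star (m : H →L[ℂ] H) = m := congrArg Subtype.val hm
    have e2 : (m : H →L[ℂ] H) * a * m = -(star ((c * m : compactOperators H) : H →L[ℂ] H) *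
        (c * m : compactOperators H)) := congrArg Subtype.val hmam
    rw [e1, e2] at h2
    have h4 : star ((c * m : compactOperators H) : H →L[ℂ] H) *
        (c * m : compactOperators H) = 0 := le_antisymm (by simpa using h2) h3
    have h5 : c * m = 0 := Subtype.ext ((CStarRing.star_mul_self_eq_zero_iff _).1 h4)
    have h6 : star m * m = 0 := by
      rw [hm]
      conv_lhs => rw [hmc, mul_assoc, ← hmc, h5, mul_zero]
    have h7 : m = 0 := (CStarRing.star_mul_self_eq_zero_iff _).1 h6
    exact ⟨b, by rw [hab, h7, sub_zero]⟩
  · rintro ⟨b, rfl⟩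
    exact star_mul_self_nonneg (b : H →L[ℂ] H)

end CompactOperators

section TraceClass

variable {H : Type*} [NormedAddCommGroup H] [InnerProductSpace ℂ H] [CompleteSpace H]

/-- A bounded operator `T` on `H` is trace class if `∑ ⟪e, |T| e⟫ < ∞` for every orthonormal basis
of `H`, where `|T| = (T⋆T)^{1/2}`. `H` need not be separable; every orthonormal basis is indexed by
the set of its vectors. -/
def IsTraceClass (T : H →L[ℂ] H) : Prop :=
  ∀ (w : Set H) (b : HilbertBasis w ℂ H),
    Summable fun i : w => RCLike.re ⟪b i, CFC.abs T (b i)⟫_ℂ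

variable (H) in
/-- An orthonormal basis of `H`, used to compute traces. -/
def traceBasis : HilbertBasis (exists_hilbertBasis ℂ H).choose ℂ H :=
  (exists_hilbertBasis ℂ H).choose_spec.choose

/-- The trace `∑ ⟪e, T e⟫` of an operator. For trace-class `T` the sum converges absolutely and does
not depend on the orthonormal basis; the trace is only used for such operators. -/
def opTrace (T : H →L[ℂ] H) : ℂ :=
  ∑' i, ⟪traceBasis H i, T (traceBasis H i)⟫_ℂ

variable (H) in
/-- The set `ℙ(H)` of positive trace-class operators on `H` with trace one. -/
def densityOperators : Set (H →L[ℂ] H) :=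
  {p | IsTraceClass p ∧ p.IsPositive ∧ opTrace p = 1}

end TraceClass

section NormDerivative

variable {X : Type*} [NormedAddCommGroup X] [NormedSpace ℝ X]

/-- The difference quotient `(‖x + ty‖² - ‖x‖²) / (2t)`. -/
def normSqQuotient (x y : X) (t : ℝ) : ℝ :=
  (‖x + t • y‖ ^ 2 - ‖x‖ ^ 2) / (2 * t)

/-- The right norm derivative `ρ₊(x, y)`, the limit of the quotient as `t → 0⁺`. -/
def rhoPlus (x y : X) : ℝ := limUnder (𝓝[>] (0 : ℝ)) (normSqQuotient x y)

/-- The left norm derivative `ρ₋(x, y)`, the limit of the quotient as `t → 0⁻`. -/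
def rhoMinus (x y : X) : ℝ := limUnder (𝓝[<] (0 : ℝ)) (normSqQuotient x y)

end NormDerivative

section Pairing

variable (A : Type*) {X : Type*} [Inner A X]

/-- The `A`-valued inner product `⟨x, y⟩` of a Hilbert `A`-module, in the convention that it is
linear in the first variable. (The inner product of `CStarModule` satisfies
`inner A x (a • y) = a * inner A x y`, so it is linear in the second one.) -/
def modulePairing (x y : X) : A := inner A y x

end Pairing

end

/-!
The function `t ↦ ‖x + ty‖²` is convex, so the one-sided limits of its slopes at `0` exist. Since
`ρ₋(x, y) = -ρ₊(x, -y)`, it is enough to identify `ρ₊`.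

Write `a = ⟨x, x⟩`, `b = ⟨x, y⟩`, `c = ⟨y, y⟩`, so that `‖x + ty‖²` is the norm of the positive
operator `⟨x + ty, x + ty⟩ = a + t(b + b⋆) + t²c`. If `p` is a density operator with square root `s`,
then `tr(pT) = ∑ ⟪s eᵢ, T s eᵢ⟫` (`exists_hasSum_opTrace_mul`): `tr(pT)` is a combination of
values of the quadratic form of `T`, with weights `‖s eᵢ‖²` of sum `1`. Hence
`tr(pa) + 2t Re tr(pb) ≤ ‖x + ty‖²`, and `tr(pa) = ‖x‖²` gives `Re tr(pb) ≤ ρ₊(x, y)`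
(`mem_normingValues_le_rhoPlus`).

For attainment, take `tₙ → 0⁺` and unit vectors `vₙ` at which the quadratic form of
`⟨x + tₙy, x + tₙy⟩` is within `tₙ²` of its norm. Then `⟪vₙ, a vₙ⟫ → ‖a‖`, and as `a` is compact and
nonzero a subsequence of `vₙ` converges in norm to a unit vector `u` with `⟪u, a u⟫ = ‖a‖ = ‖x‖²`.
The quotient at `tₙ` is at most `Re⟪vₙ, b vₙ⟫ + O(tₙ)`, so `ρ₊(x, y) ≤ Re⟪u, b u⟫`
(`exists_rhoPlus_le_re_inner`); the maximum is attained at the rank-one projection onto `u`.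
-/

/-! ### Existence of the norm derivatives -/

section NormDerivative

variable {X : Type*} [NormedAddCommGroup X] [NormedSpace ℝ X]

theorem convexOn_norm_add_smul_sq (x y : X) :
    ConvexOn ℝ Set.univ fun t : ℝ => ‖x + t • y‖ ^ 2 := by
  have h : ConvexOn ℝ Set.univ fun t : ℝ => ‖x + t • y‖ := by
    refine ⟨convex_univ, fun s _ t _ α β hα hβ hαβ => ?_⟩
    have e : x + (α • s + β • t) • y = α • (x + s • y) + β • (x + t • y) := by
      conv_lhs => rw [← one_smul ℝ x, ← hαβ]
      module
    simp only [e]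
    refine (norm_add_le _ _).trans_eq ?_
    rw [norm_smul, norm_smul, Real.norm_of_nonneg hα, Real.norm_of_nonneg hβ, smul_eq_mul,
      smul_eq_mul]
  exact h.pow (fun _ _ => norm_nonneg _) 2

/-- The quotient is half a slope of the convex function `t ↦ ‖x + ty‖²`, so it has a right limit. -/
theorem tendsto_normSqQuotient_rhoPlus (x y : X) :
    Tendsto (normSqQuotient x y) (𝓝[>] (0 : ℝ)) (𝓝 (rhoPlus x y)) := by
  refine tendsto_nhds_limUnder ?_
  have h := (convexOn_norm_add_smul_sq x y).hasDerivWithinAt_rightDeriv_of_mem_interior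
    (x := 0) (by simp)
  rw [hasDerivWithinAt_iff_tendsto_slope' (by simp)] at h
  refine ⟨_, (h.div_const 2).congr fun t => ?_⟩
  simp only [slope_def_field, normSqQuotient, zero_smul, add_zero, sub_zero]
  rw [div_div, mul_comm t 2]

theorem normSqQuotient_neg (x y : X) (t : ℝ) :
    normSqQuotient x y (-t) = -normSqQuotient x (-y) t := by
  simp only [normSqQuotient, neg_smul, smul_neg, mul_neg, div_neg]

theorem tendsto_normSqQuotient_neg_rhoPlus_neg (x y : X) :
    Tendsto (normSqQuotient x y) (𝓝[<] (0 : ℝ)) (𝓝 (-rhoPlus x (-y))) := by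
  have h : Tendsto (fun t : ℝ => -t) (𝓝[<] (0 : ℝ)) (𝓝[>] (0 : ℝ)) := by
    simpa using tendsto_neg_nhdsLT (a := (0 : ℝ))
  refine ((tendsto_normSqQuotient_rhoPlus x (-y)).comp h).neg.congr fun t => ?_
  rw [Function.comp_apply, ← normSqQuotient_neg, neg_neg]

theorem rhoMinus_eq_neg_rhoPlus_neg (x y : X) : rhoMinus x y = -rhoPlus x (-y) :=
  (tendsto_normSqQuotient_neg_rhoPlus_neg x y).limUnder_eq

end NormDerivative

/-! ### The trace pairing with a density operator -/

section Trace

variable {H : Type*} [NormedAddCommGroup H] [InnerProductSpace ℂ H]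

theorem hasSum_norm_inner_sq {ι : Type*} (e : HilbertBasis ι ℂ H) (v : H) :
    HasSum (fun i => ‖⟪e i, v⟫_ℂ‖ ^ 2) (‖v‖ ^ 2) := by
  have h := e.hasSum_inner_mul_inner v v
  simp_rw [inner_self_eq_norm_sq_to_K, ← inner_conj_symm v, RCLike.conj_mul] at h
  exact_mod_cast h

theorem summable_norm_inner_sq_prod {ι : Type*} (e : HilbertBasis ι ℂ H) (A : H →L[ℂ] H)
    (hA : Summable fun i => ‖A (e i)‖ ^ 2) :
    Summable fun q : ι × ι => ‖⟪e q.2, A (e q.1)⟫_ℂ‖ ^ 2 := by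
  rw [summable_prod_of_nonneg fun _ => by positivity]
  exact ⟨fun i => (hasSum_norm_inner_sq e (A (e i))).summable,
    hA.congr fun i => (hasSum_norm_inner_sq e (A (e i))).tsum_eq.symm⟩

variable [CompleteSpace H]

/-- The adjoint of a Hilbert–Schmidt operator is Hilbert–Schmidt. -/
theorem summable_norm_adjoint_sq {ι : Type*} (e : HilbertBasis ι ℂ H) (A : H →L[ℂ] H)
    (hA : Summable fun i => ‖A (e i)‖ ^ 2) :
    Summable fun i => ‖(star A) (e i)‖ ^ 2 := by
  have h := (summable_norm_inner_sq_prod e A hA).prod_symm.prod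
  refine h.congr fun j => ?_
  rw [← (hasSum_norm_inner_sq e ((star A) (e j))).tsum_eq]
  refine tsum_congr fun i => ?_
  rw [ContinuousLinearMap.star_eq_adjoint, ContinuousLinearMap.adjoint_inner_right,
    norm_inner_symm]
  rfl

/-- `tr(A⋆B) = tr(BA⋆)` for Hilbert–Schmidt operators `A` and `B`. -/
theorem tsum_inner_eq_tsum_inner_star {ι : Type*} (e : HilbertBasis ι ℂ H) (A B : H →L[ℂ] H)
    (hA : Summable fun i => ‖A (e i)‖ ^ 2) (hB : Summable fun i => ‖B (e i)‖ ^ 2) :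
    ∑' i, ⟪A (e i), B (e i)⟫_ℂ = ∑' j, ⟪(star B) (e j), (star A) (e j)⟫_ℂ := by
  have hs : Summable (Function.uncurry fun i j => ⟪A (e i), e j⟫_ℂ * ⟪e j, B (e i)⟫_ℂ) := by
    refine .of_norm_bounded ((summable_norm_inner_sq_prod e A hA).add
      (summable_norm_inner_sq_prod e B hB)) fun q => ?_
    change ‖⟪A (e q.1), e q.2⟫_ℂ * ⟪e q.2, B (e q.1)⟫_ℂ‖ ≤ _
    rw [norm_mul, norm_inner_symm (A (e q.1)) (e q.2)]
    have hαβ : ∀ α β : ℝ, α * β ≤ α ^ 2 + β ^ 2 := fun α β => by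
      nlinarith [sq_nonneg (α - β), sq_nonneg α, sq_nonneg β]
    exact hαβ _ _
  calc ∑' i, ⟪A (e i), B (e i)⟫_ℂ
      = ∑' i, ∑' j, ⟪A (e i), e j⟫_ℂ * ⟪e j, B (e i)⟫_ℂ :=
        tsum_congr fun i => (e.tsum_inner_mul_inner (A (e i)) (B (e i))).symm
    _ = ∑' j, ∑' i, ⟪A (e i), e j⟫_ℂ * ⟪e j, B (e i)⟫_ℂ := hs.tsum_comm.symm
    _ = _ := tsum_congr fun j => by
        rw [← e.tsum_inner_mul_inner ((star B) (e j)) ((star A) (e j))]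
        refine tsum_congr fun i => ?_
        rw [ContinuousLinearMap.star_eq_adjoint, ContinuousLinearMap.star_eq_adjoint,
          ContinuousLinearMap.adjoint_inner_right, ContinuousLinearMap.adjoint_inner_left, mul_comm]

/-- A density operator `p` acts by a convex combination of vector states: with `s = √p`, the trace
of `pT` is `∑ ⟪s eᵢ, T s eᵢ⟫`, by moving one factor `s` around the trace. -/
theorem exists_hasSum_opTrace_mul {p : H →L[ℂ] H} (hp : p ∈ densityOperators H) :
    ∃ (w : Set H) (v : w → H), HasSum (fun i => ‖v i‖ ^ 2) 1 ∧
      ∀ T : H →L[ℂ] H, HasSum (fun i => ⟪v i, T (v i)⟫_ℂ) (opTrace (p * T)) := by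
  obtain ⟨htr, hpos, h1⟩ := hp
  have hp0 : 0 ≤ p := ContinuousLinearMap.nonneg_iff_isPositive p |>.2 hpos
  set e := traceBasis H
  set s := CFC.sqrt p
  have hss : s * s = p := CFC.sqrt_mul_sqrt_self p hp0
  have hsa : star s = s := (IsSelfAdjoint.of_nonneg (CFC.sqrt_nonneg p)).star_eq
  have hmul : ∀ (T : H →L[ℂ] H) (u : H), ⟪u, (p * T) u⟫_ℂ = ⟪s u, (s * T) u⟫_ℂ := fun T u => by
    rw [← hss]
    conv_rhs => rw [← hsa, ContinuousLinearMap.star_eq_adjoint,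
      ContinuousLinearMap.adjoint_inner_left, ← ContinuousLinearMap.star_eq_adjoint, hsa]
    rfl
  have hself : ∀ u : H, ⟪u, p u⟫_ℂ = (‖s u‖ ^ 2 : ℝ) := fun u => by
    have := hmul 1 u
    rw [mul_one, mul_one, inner_self_eq_norm_sq_to_K] at this
    exact_mod_cast this
  have hsum : Summable fun i => ‖s (e i)‖ ^ 2 := by
    have h := htr _ e
    rw [CFC.abs_of_nonneg p hp0] at h
    simpa only [hself, RCLike.re_to_complex, Complex.ofReal_re] using h
  refine ⟨_, fun i => s (e i), ?_, fun T => ?_⟩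
  · have h2 : ((∑' i, ‖s (e i)‖ ^ 2 : ℝ) : ℂ) = 1 := by
      rw [← h1, Complex.ofReal_tsum]
      exact tsum_congr fun i => (hself _).symm
    rw [← Complex.ofReal_one, Complex.ofReal_inj] at h2
    exact h2 ▸ hsum.hasSum
  · have hsT : Summable fun i => ‖(s * T) (e i)‖ ^ 2 := by
      have h3 : Summable fun i => ‖(star T * s) (e i)‖ ^ 2 := by
        refine .of_nonneg_of_le (fun _ => by positivity) (fun i => ?_)
          (hsum.mul_left (‖star T‖ ^ 2))
        rw [← mul_pow]
        gcongr
        exact (star T).le_opNorm _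
      simpa [hsa] using summable_norm_adjoint_sq e _ h3
    have h4 : opTrace (p * T) = ∑' i, ⟪s (e i), T (s (e i))⟫_ℂ := by
      calc opTrace (p * T) = ∑' i, ⟪s (e i), (s * T) (e i)⟫_ℂ := tsum_congr fun i => hmul T _
        _ = _ := tsum_inner_eq_tsum_inner_star e s (s * T) hsum hsT
        _ = _ := tsum_congr fun i => by
          rw [star_mul, hsa, mul_apply_eq_comp, ContinuousLinearMap.star_eq_adjoint,
            ContinuousLinearMap.adjoint_inner_left]
    rw [h4]
    refine (Summable.of_norm_bounded (hsum.mul_left ‖T‖) fun i => ?_).hasSum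
    refine (norm_inner_le_norm _ _).trans ?_
    rw [pow_two, mul_left_comm]
    gcongr
    exact T.le_opNorm _

theorem opTrace_rankOne_mul (v : H) (T : H →L[ℂ] H) :
    opTrace (InnerProductSpace.rankOne ℂ v v * T) = ⟪v, T v⟫_ℂ := by
  rw [← ContinuousLinearMap.adjoint_inner_left, ← (traceBasis H).tsum_inner_mul_inner]
  refine tsum_congr fun i => ?_
  rw [mul_apply_eq_comp, InnerProductSpace.rankOne_apply, inner_smul_right,
    ContinuousLinearMap.adjoint_inner_left]

theorem rankOne_mem_densityOperators {v : H} (hv : ‖v‖ = 1) :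
    InnerProductSpace.rankOne ℂ v v ∈ densityOperators H := by
  have hpos := InnerProductSpace.isPositive_rankOne_self (𝕜 := ℂ) v
  refine ⟨fun w b => ?_, hpos, ?_⟩
  · rw [CFC.abs_of_nonneg _ ((ContinuousLinearMap.nonneg_iff_isPositive _).2 hpos)]
    refine (hasSum_norm_inner_sq b v).summable.congr fun i => ?_
    rw [InnerProductSpace.rankOne_apply, inner_smul_right, ← inner_conj_symm v, RCLike.conj_mul]
    norm_cast
  · rw [← mul_one (InnerProductSpace.rankOne ℂ v v), opTrace_rankOne_mul]
    simp [inner_self_eq_norm_sq_to_K, hv]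

end Trace

/-! ### Almost maximizing vectors of quadratic forms -/

section CompactOperators

variable {H : Type*} [NormedAddCommGroup H] [InnerProductSpace ℂ H]

theorem re_inner_apply_le (T : H →L[ℂ] H) (v : H) : (⟪v, T v⟫_ℂ).re ≤ ‖T‖ * ‖v‖ ^ 2 := by
  refine (Complex.re_le_norm _).trans ((norm_inner_le_norm _ _).trans ?_)
  rw [pow_two, mul_left_comm]
  gcongr
  exact T.le_opNorm _

/-- Unit vectors `v` with `Re⟪v, a v⟫` tending to `‖a‖` satisfy `a v - ‖a‖ v → 0`, and compactness
of `a` makes `a v`, hence `v` itself, converge along a subsequence. -/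
theorem exists_subseq_tendsto_of_tendsto_norm {a : H →L[ℂ] H} (ha : IsCompactOperator a)
    (h0 : a ≠ 0) {v : ℕ → H} (hv : ∀ n, ‖v n‖ = 1)
    (hlim : Tendsto (fun n => (⟪v n, a (v n)⟫_ℂ).re) atTop (𝓝 ‖a‖)) :
    ∃ (u : H) (φ : ℕ → ℕ), StrictMono φ ∧ Tendsto (v ∘ φ) atTop (𝓝 u) := by
  obtain ⟨w, -, φ, hφ, hw⟩ := (ha.isCompact_closure_image_closedBall
    (f := (a : H →ₗ[ℂ] H)) 1).tendsto_subseq (x := fun n => a (v n))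
    fun n => subset_closure ⟨v n, by simp [hv n], rfl⟩
  have hpos : 0 < ‖a‖ := norm_pos_iff.2 h0
  refine ⟨((‖a‖⁻¹ : ℝ) : ℂ) • w, φ, hφ, ?_⟩
  -- `‖a v - ‖a‖ v‖² ≤ 2‖a‖² - 2‖a‖ Re⟪v, a v⟫` for a unit vector `v`
  have hbd : ∀ n, ‖a (v n) - (‖a‖ : ℂ) • v n‖ ^ 2
      ≤ 2 * ‖a‖ ^ 2 - 2 * ‖a‖ * (⟪v n, a (v n)⟫_ℂ).re := fun n => by
    have h1 : ‖a (v n)‖ ≤ ‖a‖ := by simpa [hv n] using a.le_opNorm (v n)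
    rw [@norm_sub_sq ℂ, inner_smul_right, norm_smul, hv n, ← inner_conj_symm]
    simp only [RCLike.re_to_complex, Complex.re_ofReal_mul, Complex.conj_re, Complex.norm_real,
      norm_norm]
    nlinarith [norm_nonneg (a (v n))]
  have hz : Tendsto (fun n => a (v n) - (‖a‖ : ℂ) • v n) atTop (𝓝 0) := by
    rw [tendsto_zero_iff_norm_tendsto_zero]
    have h2 : Tendsto (fun n => ‖a (v n) - (‖a‖ : ℂ) • v n‖ ^ 2) atTop (𝓝 0) := by
      refine squeeze_zero (fun _ => by positivity) hbd ?_
      have h3 := (hlim.const_mul (2 * ‖a‖)).const_sub (2 * ‖a‖ ^ 2)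
      convert h3 using 2
      ring
    simpa using h2.sqrt
  have h4 := (hw.sub (hz.comp hφ.tendsto_atTop)).const_smul ((‖a‖⁻¹ : ℝ) : ℂ)
  rw [sub_zero] at h4
  refine h4.congr fun n => ?_
  simp only [Function.comp_apply, sub_sub_cancel, smul_smul]
  rw [← Complex.ofReal_mul, inv_mul_cancel₀ hpos.ne', Complex.ofReal_one, one_smul]

variable [CompleteSpace H]

/-- The quadratic form of a positive operator comes arbitrarily close to the norm on the unit
sphere. -/
theorem exists_norm_sub_lt_re_inner [Nontrivial H] {T : H →L[ℂ] H} (hT : 0 ≤ T) {ε : ℝ}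
    (hε : 0 < ε) : ∃ v : H, ‖v‖ = 1 ∧ ‖T‖ - ε < (⟪v, T v⟫_ℂ).re := by
  have hpos := (ContinuousLinearMap.nonneg_iff_isPositive _).1 hT
  by_contra! h
  have hall : ∀ v : H, (⟪v, T v⟫_ℂ).re ≤ (‖T‖ - ε) * ‖v‖ ^ 2 := by
    intro v
    rcases eq_or_ne v 0 with rfl | hv
    · simp
    have hv' : ‖v‖ ≠ 0 := norm_ne_zero_iff.2 hv
    have h1 := h (((‖v‖⁻¹ : ℝ) : ℂ) • v) (by simp [norm_smul, hv'])
    rw [map_smul, inner_smul_left, inner_smul_right, Complex.conj_ofReal, Complex.re_ofReal_mul,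
      Complex.re_ofReal_mul] at h1
    have h2 : (⟪v, T v⟫_ℂ).re = (‖v‖⁻¹ * (‖v‖⁻¹ * (⟪v, T v⟫_ℂ).re)) * ‖v‖ ^ 2 := by field_simp
    rw [h2]
    gcongr
  have hm : 0 ≤ ‖T‖ - ε := by
    obtain ⟨v, hv⟩ := exists_norm_eq H zero_le_one
    have := (hpos.re_inner_nonneg_right v).trans (hall v)
    simpa [hv] using this
  -- the quadratic form of `T` is at most `‖T‖ - ε`, so `T ≤ ‖T‖ - ε` in the C⋆-order
  have hle : ‖T‖ ≤ ‖T‖ - ε := by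
    rw [CStarAlgebra.norm_le_iff_le_algebraMap T hm hT, ContinuousLinearMap.le_def]
    refine (ContinuousLinearMap.isPositive_iff_complex _).2 fun v => ?_
    have e : (algebraMap ℝ (H →L[ℂ] H) (‖T‖ - ε) - T) v = ((‖T‖ - ε : ℝ) : ℂ) • v - T v := by
      rw [Algebra.algebraMap_eq_smul_one]
      simp [-Complex.ofReal_sub]
    have hreal : ((⟪v, T v⟫_ℂ).re : ℂ) = ⟪v, T v⟫_ℂ :=
      hpos.isSymmetric.coe_re_inner_self_apply v
    have e2 : ⟪((‖T‖ - ε : ℝ) : ℂ) • v - T v, v⟫_ℂ =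
        (((‖T‖ - ε) * ‖v‖ ^ 2 - (⟪v, T v⟫_ℂ).re : ℝ) : ℂ) := by
      rw [inner_sub_left, inner_smul_left, Complex.conj_ofReal, inner_self_eq_norm_sq_to_K,
        ← inner_conj_symm (T v), ← hreal, Complex.conj_ofReal]
      simp
    rw [e, e2]
    exact ⟨rfl, sub_nonneg.2 (hall v)⟩
  linarith

end CompactOperators

/-! ### Norm derivatives in the Hilbert module -/

section HilbertModule

variable {H : Type*} [NormedAddCommGroup H] [InnerProductSpace ℂ H] [CompleteSpace H]
  {X : Type*} [NormedAddCommGroup X] [NormedSpace ℂ X]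
  [SMul (compactOperators H) X] [CStarModule (compactOperators H) X]

theorem norm_modulePairing_self (x : X) :
    ‖(modulePairing (compactOperators H) x x : H →L[ℂ] H)‖ = ‖x‖ ^ 2 := by
  rw [CStarModule.norm_eq_sqrt_norm_inner_self (A := compactOperators H) x,
    Real.sq_sqrt (norm_nonneg _)]
  rfl

theorem modulePairing_self_nonneg (x : X) :
    (0 : H →L[ℂ] H) ≤ (modulePairing (compactOperators H) x x : H →L[ℂ] H) :=
  CStarModule.inner_self_nonneg (A := compactOperators H) (x := x)

theorem re_inner_modulePairing_add_smul (x y : X) (t : ℝ) (v : H) :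
    (⟪v, (modulePairing (compactOperators H) (x + t • y) (x + t • y) : H →L[ℂ] H) v⟫_ℂ).re =
      (⟪v, (modulePairing (compactOperators H) x x : H →L[ℂ] H) v⟫_ℂ).re
      + 2 * t * (⟪v, (modulePairing (compactOperators H) x y : H →L[ℂ] H) v⟫_ℂ).re
      + t ^ 2 * (⟪v, (modulePairing (compactOperators H) y y : H →L[ℂ] H) v⟫_ℂ).re := by
  have e1 : (modulePairing (compactOperators H) y x : H →L[ℂ] H) =
      star (modulePairing (compactOperators H) x y : H →L[ℂ] H) :=
    congrArg Subtype.val (CStarModule.star_inner (A := compactOperators H) y x).symm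
  have e2 : (modulePairing (compactOperators H) (x + t • y) (x + t • y) : H →L[ℂ] H) =
      (modulePairing (compactOperators H) x x : H →L[ℂ] H)
      + (t : ℂ) • (modulePairing (compactOperators H) x y : H →L[ℂ] H)
      + (t : ℂ) • (modulePairing (compactOperators H) y x : H →L[ℂ] H)
      + (t : ℂ) • (t : ℂ) • (modulePairing (compactOperators H) y y : H →L[ℂ] H) := by
    rw [← Complex.coe_smul t y]
    simp only [modulePairing, CStarModule.inner_add_left, CStarModule.inner_add_right,
      CStarModule.inner_smul_right_complex, CStarModule.inner_smul_left_complex]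
    simp
    abel
  rw [e2, e1]
  simp only [add_apply, smul_apply, inner_add_right,
    inner_smul_right, ContinuousLinearMap.star_eq_adjoint, ContinuousLinearMap.adjoint_inner_right,
    Complex.add_re, Complex.re_ofReal_mul]
  rw [← inner_conj_symm ((modulePairing (compactOperators H) x y : H →L[ℂ] H) v), Complex.conj_re]
  ring

/-- A vector state bounds `‖x + ty‖²` from below to first order. -/
theorem re_inner_add_le_norm_sq (x y : X) (t : ℝ) (v : H) :
    (⟪v, (modulePairing (compactOperators H) x x : H →L[ℂ] H) v⟫_ℂ).re
      + 2 * t * (⟪v, (modulePairing (compactOperators H) x y : H →L[ℂ] H) v⟫_ℂ).re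
      ≤ ‖x + t • y‖ ^ 2 * ‖v‖ ^ 2 := by
  have h := re_inner_apply_le
    (modulePairing (compactOperators H) (x + t • y) (x + t • y) : H →L[ℂ] H) v
  rw [norm_modulePairing_self, re_inner_modulePairing_add_smul] at h
  have h2 : 0 ≤ (⟪v, (modulePairing (compactOperators H) y y : H →L[ℂ] H) v⟫_ℂ).re :=
    ((ContinuousLinearMap.nonneg_iff_isPositive _).1
      (modulePairing_self_nonneg y)).re_inner_nonneg_right v
  nlinarith [mul_nonneg (sq_nonneg t) h2]

variable (H) in
/-- The values `Re tr(p⟨x, y⟩)` at the density operators `p` that norm `⟨x, x⟩`. -/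
def normingValues (x y : X) : Set ℝ :=
  {r : ℝ | ∃ p ∈ densityOperators H,
    opTrace (p * (modulePairing (compactOperators H) x x : H →L[ℂ] H)) = (‖x‖ ^ 2 : ℝ) ∧
    r = (opTrace (p * (modulePairing (compactOperators H) x y : H →L[ℂ] H))).re}

theorem mem_normingValues_le_rhoPlus {x y : X} {r : ℝ} (hr : r ∈ normingValues H x y) :
    r ≤ rhoPlus x y := by
  obtain ⟨p, hp, hpx, rfl⟩ := hr
  refine ge_of_tendsto (tendsto_normSqQuotient_rhoPlus x y) ?_
  filter_upwards [self_mem_nhdsWithin] with t ht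
  have ht : 0 < t := ht
  obtain ⟨w, v, hv, htr⟩ := exists_hasSum_opTrace_mul hp
  have h := hasSum_le (fun i => re_inner_add_le_norm_sq (H := H) x y t (v i))
    ((Complex.hasSum_re (htr _)).add ((Complex.hasSum_re (htr _)).mul_left (2 * t)))
    (hv.mul_left (‖x + t • y‖ ^ 2))
  rw [hpx, Complex.ofReal_re, mul_one] at h
  rw [normSqQuotient, le_div_iff₀ (by positivity)]
  linarith

theorem re_inner_mem_normingValues {x y : X} {v : H} (hv : ‖v‖ = 1)
    (hx : (⟪v, (modulePairing (compactOperators H) x x : H →L[ℂ] H) v⟫_ℂ).re = ‖x‖ ^ 2) :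
    (⟪v, (modulePairing (compactOperators H) x y : H →L[ℂ] H) v⟫_ℂ).re ∈ normingValues H x y := by
  refine ⟨_, rankOne_mem_densityOperators hv, ?_, by rw [opTrace_rankOne_mul]⟩
  have hpos := (ContinuousLinearMap.nonneg_iff_isPositive _).1
    (modulePairing_self_nonneg (H := H) x)
  rw [opTrace_rankOne_mul, ← hx]
  exact (hpos.isSymmetric.coe_re_inner_self_apply v).symm

theorem neg_mem_normingValues_neg {x y : X} {r : ℝ} (hr : r ∈ normingValues H x y) :
    -r ∈ normingValues H x (-y) := by
  obtain ⟨p, hp, hpx, rfl⟩ := hr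
  refine ⟨p, hp, hpx, ?_⟩
  have e : (modulePairing (compactOperators H) x (-y) : H →L[ℂ] H) =
      -(modulePairing (compactOperators H) x y : H →L[ℂ] H) :=
    congrArg Subtype.val (CStarModule.inner_neg_left (A := compactOperators H) (x := y) (y := x))
  rw [e, mul_neg]
  simp [opTrace, tsum_neg]

variable [Nontrivial H]

variable (H) in
/-- For `x ≠ 0`, unit vectors almost norming `⟨x + ty, x + ty⟩` accumulate, as `t → 0⁺`, at a vector
`u` norming `⟨x, x⟩`, and the vector state of `u` dominates the limit of the quotients. -/
theorem exists_rhoPlus_le_re_inner (x y : X) : ∃ v : H, ‖v‖ = 1 ∧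
    (⟪v, (modulePairing (compactOperators H) x x : H →L[ℂ] H) v⟫_ℂ).re = ‖x‖ ^ 2 ∧
    rhoPlus x y ≤ (⟪v, (modulePairing (compactOperators H) x y : H →L[ℂ] H) v⟫_ℂ).re := by
  rcases eq_or_ne x 0 with rfl | hx
  -- if `x = 0`, the quotient is `t‖y‖²/2` and both sides vanish
  · obtain ⟨v, hv⟩ := exists_norm_eq H zero_le_one
    have hz : ∀ z : X, (modulePairing (compactOperators H) 0 z : H →L[ℂ] H) = 0 := fun z =>
      congrArg Subtype.val (CStarModule.inner_zero_right (A := compactOperators H) (x := z))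
    refine ⟨v, hv, by simp [hz], ?_⟩
    have hlim : Tendsto (fun t : ℝ => t * (‖y‖ ^ 2 / 2)) (𝓝[>] 0) (𝓝 0) := by
      have : Tendsto (fun t : ℝ => t * (‖y‖ ^ 2 / 2)) (𝓝 0) (𝓝 (0 * (‖y‖ ^ 2 / 2))) :=
        tendsto_id.mul_const _
      rw [zero_mul] at this
      exact this.mono_left nhdsWithin_le_nhds
    rw [hz, zero_apply, inner_zero_right, Complex.zero_re]
    refine (tendsto_nhds_unique (tendsto_normSqQuotient_rhoPlus 0 y) (hlim.congr' ?_)).le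
    filter_upwards [self_mem_nhdsWithin] with t ht
    have ht : 0 < t := ht
    simp only [normSqQuotient, zero_add, norm_zero, norm_smul, Real.norm_of_nonneg ht.le]
    field_simp
    ring
  obtain ⟨t, ht0, htpos⟩ : ∃ t : ℕ → ℝ, Tendsto t atTop (𝓝 0) ∧ ∀ n, 0 < t n :=
    ⟨_, tendsto_one_div_add_atTop_nhds_zero_nat, fun _ => Nat.one_div_pos_of_nat⟩
  have hex : ∀ n, ∃ v : H, ‖v‖ = 1 ∧ ‖x + t n • y‖ ^ 2 - t n ^ 2 <
      (⟪v, (modulePairing (compactOperators H) (x + t n • y) (x + t n • y) : H →L[ℂ] H) v⟫_ℂ).re :=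
    fun n => by
      have := exists_norm_sub_lt_re_inner (modulePairing_self_nonneg (H := H) (x + t n • y))
        (pow_pos (htpos n) 2)
      rwa [norm_modulePairing_self] at this
  choose v hv hlt using hex
  simp only [re_inner_modulePairing_add_smul] at hlt
  have hunit : ∀ (T : H →L[ℂ] H) (n : ℕ), (⟪v n, T (v n)⟫_ℂ).re ≤ ‖T‖ := fun T n => by
    simpa [hv n] using re_inner_apply_le T (v n)
  have hxx := hunit (modulePairing (compactOperators H) x x : H →L[ℂ] H)
  have hxy := hunit (modulePairing (compactOperators H) x y : H →L[ℂ] H)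
  have hyy := hunit (modulePairing (compactOperators H) y y : H →L[ℂ] H)
  have hnorm := norm_modulePairing_self (H := H) x
  have hcompact : IsCompactOperator (modulePairing (compactOperators H) x x : H →L[ℂ] H) :=
    (modulePairing (compactOperators H) x x).2
  rw [norm_modulePairing_self] at hxx hyy
  generalize (modulePairing (compactOperators H) x x : H →L[ℂ] H) = a at *
  generalize (modulePairing (compactOperators H) x y : H →L[ℂ] H) = b at *
  generalize (modulePairing (compactOperators H) y y : H →L[ℂ] H) = c at *
  have hlow : ∀ n, ‖x + t n • y‖ ^ 2 - t n ^ 2 * (1 + ‖y‖ ^ 2) ≤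
      (⟪v n, a (v n)⟫_ℂ).re + 2 * t n * (⟪v n, b (v n)⟫_ℂ).re := fun n => by
    nlinarith [hlt n, mul_le_mul_of_nonneg_left (hyy n) (sq_nonneg (t n))]
  have ha : Tendsto (fun n => (⟪v n, a (v n)⟫_ℂ).re) atTop (𝓝 ‖a‖) := by
    rw [hnorm]
    have h1 : Tendsto (fun n => ‖x + t n • y‖ ^ 2 - t n ^ 2 * (1 + ‖y‖ ^ 2) - 2 * t n * ‖b‖) atTop
        (𝓝 (‖x + (0 : ℝ) • y‖ ^ 2 - 0 ^ 2 * (1 + ‖y‖ ^ 2) - 2 * 0 * ‖b‖)) :=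
      ((((ht0.smul_const y).const_add x).norm.pow 2).sub ((ht0.pow 2).mul_const _)).sub
        ((ht0.const_mul 2).mul_const _)
    simp only [zero_smul, add_zero, ne_eq, OfNat.ofNat_ne_zero, not_false_eq_true, zero_pow,
      zero_mul, sub_zero, mul_zero] at h1
    refine tendsto_of_tendsto_of_tendsto_of_le_of_le h1 tendsto_const_nhds (fun n => ?_) hxx
    dsimp only
    linarith [hlow n, mul_le_mul_of_nonneg_left (hxy n) (htpos n).le]
  have ha0 : a ≠ 0 := by
    rintro rfl
    rw [norm_zero] at hnorm
    exact hx (norm_eq_zero.1 (pow_eq_zero_iff two_ne_zero |>.1 hnorm.symm))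
  obtain ⟨u, φ, hφ, hu⟩ := exists_subseq_tendsto_of_tendsto_norm hcompact ha0 hv ha
  have hform : ∀ T : H →L[ℂ] H, Tendsto (fun n => (⟪v (φ n), T (v (φ n))⟫_ℂ).re) atTop
      (𝓝 (⟪u, T u⟫_ℂ).re) := fun T =>
    (Complex.continuous_re.tendsto _).comp (hu.inner ((T.continuous.tendsto u).comp hu))
  refine ⟨u, ?_, ?_, ?_⟩
  · refine tendsto_nhds_unique hu.norm (tendsto_const_nhds.congr fun n => (hv _).symm)
  · rw [← hnorm]
    exact tendsto_nhds_unique (hform a) (ha.comp hφ.tendsto_atTop)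
  · have htφ := ht0.comp hφ.tendsto_atTop
    have hq := (tendsto_normSqQuotient_rhoPlus x y).comp
      (tendsto_nhdsWithin_iff.2 ⟨htφ, .of_forall fun n => htpos _⟩)
    have hr := (hform b).add (htφ.mul_const ((1 + ‖y‖ ^ 2) / 2))
    rw [zero_mul, add_zero] at hr
    refine le_of_tendsto_of_tendsto' hq hr fun n => ?_
    have hpos := htpos (φ n)
    simp only [Function.comp_apply, normSqQuotient]
    rw [div_le_iff₀ (by positivity)]
    linarith [hlow (φ n), hxx (φ n)]

theorem isGreatest_normingValues (x y : X) : IsGreatest (normingValues H x y) (rhoPlus x y) := by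
  obtain ⟨v, hv, hx, hle⟩ := exists_rhoPlus_le_re_inner H x y
  have hmem := re_inner_mem_normingValues (y := y) hv hx
  exact ⟨hle.antisymm (mem_normingValues_le_rhoPlus hmem) ▸ hmem,
    fun r hr => mem_normingValues_le_rhoPlus hr⟩

theorem isLeast_normingValues (x y : X) : IsLeast (normingValues H x y) (rhoMinus x y) := by
  have h := isGreatest_normingValues (H := H) x (-y)
  rw [rhoMinus_eq_neg_rhoPlus_neg]
  refine ⟨by simpa using neg_mem_normingValues_neg h.1, fun r hr => ?_⟩
  exact neg_le.1 (h.2 (neg_mem_normingValues_neg hr))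

end HilbertModule

/-- Norm derivatives in a Hilbert module over the compact operators: the limits defining `ρ₊(x, y)`
and `ρ₋(x, y)` exist, and they are the maximum and the minimum of `Re tr(p⟨x, y⟩)`. -/
theorem proposition2p6
    {H : Type*} [NormedAddCommGroup H] [InnerProductSpace ℂ H] [CompleteSpace H] [Nontrivial H]
    {X : Type*} [NormedAddCommGroup X] [NormedSpace ℂ X] [CompleteSpace X]
    [SMul (compactOperators H) X] [CStarModule (compactOperators H) X]
    (x y : X) :
    (Tendsto (normSqQuotient x y) (𝓝[>] (0 : ℝ)) (𝓝 (rhoPlus x y)) ∧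
      IsGreatest
        {r : ℝ | ∃ p ∈ densityOperators H,
          opTrace (p * (modulePairing (compactOperators H) x x : H →L[ℂ] H)) = (‖x‖ ^ 2 : ℝ) ∧
          r = (opTrace (p * (modulePairing (compactOperators H) x y : H →L[ℂ] H))).re}
        (rhoPlus x y)) ∧
    (Tendsto (normSqQuotient x y) (𝓝[<] (0 : ℝ)) (𝓝 (rhoMinus x y)) ∧
      IsLeast
        {r : ℝ | ∃ p ∈ densityOperators H,
          opTrace (p * (modulePairing (compactOperators H) x x : H →L[ℂ] H)) = (‖x‖ ^ 2 : ℝ) ∧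
          r = (opTrace (p * (modulePairing (compactOperators H) x y : H →L[ℂ] H))).re}
        (rhoMinus x y)) := by
  exact ⟨⟨tendsto_normSqQuotient_rhoPlus x y, isGreatest_normingValues x y⟩,
    rhoMinus_eq_neg_rhoPlus_neg x y ▸ tendsto_normSqQuotient_neg_rhoPlus_neg x y,
    isLeast_normingValues x y⟩
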